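/- Let $k\ge 2$ be an odd integer and let $G=(V,E)$ be a finite simple bipartite graph (not necessarily connected) in which every vertex has degree $k$. Then $G$ is antimagic: there exists a bijection $f:E\to\{1,\dots,|E|\}$ such that the vertex sums $s(v)=\sum_{e\ni v}f(e)$, taken over the edges $e$ incident to $v$, are pairwise distinct, i.e. $s(u)\neq s(v)$ for all distinct $u,v\in V$. -/

import Mathlib

namespace SimpleGraph

variable {V : Type*} [Fintype V] [DecidableEq V]

/-- `f` restricts to a bijection from the edge set of `G` onto `{1, …, |E(G)|}`.
The values of `f` on pairs that are not edges of `G` play no role. -/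
def IsLabeling (G : SimpleGraph V) [DecidableRel G.Adj] (f : Sym2 V → ℕ) : Prop :=
  Set.BijOn f G.edgeSet (Set.Icc 1 G.edgeFinset.card)

/-- The sum at `v`: the sum of the labels on the edges of `G` incident to `v`. -/
def vertexSum (G : SimpleGraph V) [DecidableRel G.Adj] (f : Sym2 V → ℕ) (v : V) : ℕ :=
  ∑ e ∈ G.incidenceFinset v, f e

/-- `G` has a labeling whose vertex sums are pairwise distinct. -/
def IsAntimagic (G : SimpleGraph V) [DecidableRel G.Adj] : Prop :=
  ∃ f : Sym2 V → ℕ, G.IsLabeling f ∧ Function.Injective (G.vertexSum f)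

end SimpleGraph

open Finset

/-! Let `A`, `B` be the colour classes, of common size `n`, and write `k = 2 * q + 3`. By König the
edges split into `k` perfect matchings: one distinguished, the rest forming `q + 1` pairs. The
distinguished matching receives the multiples of `k`. Pair `r` receives the labels congruent to `±(r
+ 1)` mod `k`, arranged so that its two labels at each `a ∈ A` add up to `k * n`. The sums on `A`
are then distinct multiples of `k`, at most `(q + 2) * k * n`.

At `b ∈ B`, every pair but pair 0 contributes a multiple of `k`. Pair 0 contributes `±2` mod `k` if
its signs alternate along the cycles of the permutation `τ` of `A` that it defines. So the sum at
`b` is not a multiple of `k`, and differs from all sums on `A`. An odd cycle forces one exception;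
these bad vertices form `Z`, and `3 * #Z ≤ n` since `τ` has no fixed points. Their sums are
multiples of `k`, and are made larger than every sum on `A`: pair 0 is numbered with long steps at
`Z`, the distinguished matching has its largest labels there, and the other pairs are numbered so as
to lose at most `k * (#Z - 1)` (`exists_numberings_of_perms`).

Finally the distinguished labels increase with the partial sums `W`, separately on `Z` and off it,
which separates the sums inside `B`. -/

/-- The number of elements whose key is smaller than that of `a`. -/
def keyRank {A α : Type*} [Fintype A] [LinearOrder α] (key : A → α) (a : A) : ℕ :=
  #{x | key x < key a}

/-! ### Ranks of keys -/

section keyRank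

variable {A α : Type*} [Fintype A] [LinearOrder α] {key : A → α}

theorem keyRank_lt_keyRank {a b : A} (h : key a < key b) : keyRank key a < keyRank key b := by
  apply card_lt_card
  refine ⟨fun x hx => ?_, fun hs => ?_⟩
  · simp only [mem_filter, mem_univ, true_and] at hx ⊢
    exact hx.trans h
  · have := hs (show a ∈ _ by simpa using h)
    simp at this

theorem keyRank_lt_card (a : A) : keyRank key a < Fintype.card A := by
  apply card_lt_card
  refine ⟨subset_univ _, fun hs => ?_⟩
  have := hs (mem_univ a)
  simp at this

theorem keyRank_injective (hkey : Function.Injective key) : Function.Injective (keyRank key) := by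
  intro a b h
  rcases lt_trichotomy (key a) (key b) with hlt | heq | hlt
  · exact absurd h (keyRank_lt_keyRank hlt).ne
  · exact hkey heq
  · exact absurd h (keyRank_lt_keyRank hlt).ne'

theorem key_le_of_keyRank_lt {a b : A} (h : keyRank key a < keyRank key b) : key a ≤ key b := by
  by_contra hlt
  exact absurd h (keyRank_lt_keyRank (not_le.1 hlt)).not_gt

theorem keyRank_eq_succ [DecidableEq A] {key : A → ℕ} (hkey : Function.Injective key) {a b : A}
    (h : key b = key a + 1) : keyRank key b = keyRank key a + 1 := by
  have : ({x | key x < key b} : Finset A) =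
      insert a ({x | key x < key a} : Finset A) := by
    ext x
    simp only [mem_filter, mem_univ, true_and, mem_insert, h, ← hkey.eq_iff]
    omega
  rw [keyRank, this, card_insert_of_notMem (by simp), keyRank]

end keyRank

/-! ### Numberings along the cycles of a permutation -/

namespace Equiv.Perm

/-- Every orbit of `σ` gets a root `ρ`, and `d` counts the steps from the root. The root is the
successor of an element of the orbit at which `w` is maximal. -/
theorem exists_cycle_coordinates {A : Type*} [Finite A] (σ : Perm A) (w : A → ℤ) :
    ∃ (ρ : A → A) (d : A → ℕ), (∀ a, σ.SameCycle (ρ a) a) ∧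
      (∀ a b, σ.SameCycle a b → ρ a = ρ b) ∧ (∀ a, d (ρ a) = 0) ∧
      (∀ a, σ a ≠ ρ a → d (σ a) = d a + 1) ∧ (∀ a b, ρ a = ρ b → d a = d b → a = b) ∧
      (∀ a b, σ.SameCycle a b → σ a = ρ a → w b ≤ w a) := by
  classical
  have hmax : ∀ q : Quotient (SameCycle.setoid σ), ∃ v : A,
      Quotient.mk (SameCycle.setoid σ) v = q ∧
      ∀ b, Quotient.mk (SameCycle.setoid σ) b = q → w b ≤ w v := by
    intro q
    obtain ⟨v, hv, hm⟩ := Set.exists_max_image {b | Quotient.mk (SameCycle.setoid σ) b = q} w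
      (Set.toFinite _) (Quotient.exists_rep q)
    exact ⟨v, hv, hm⟩
  choose v hv hvmax using hmax
  have hsame : ∀ a b, σ.SameCycle a b ↔
      Quotient.mk (SameCycle.setoid σ) a = Quotient.mk (SameCycle.setoid σ) b :=
    fun a b => (Quotient.eq (r := SameCycle.setoid σ)).symm
  set ρ : A → A := fun a => σ (v (Quotient.mk (SameCycle.setoid σ) a)) with hρ
  have hρs : ∀ a, σ.SameCycle (ρ a) a := fun a =>
    sameCycle_apply_left.2 ((hsame _ _).2 (hv _))
  have hρe : ∀ a b, σ.SameCycle a b → ρ a = ρ b := fun a b h => by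
    simp only [hρ, (hsame a b).1 h]
  have hex : ∀ a, ∃ i : ℕ, (σ ^ i) (ρ a) = a := fun a => (hρs a).exists_nat_pow_eq
  have hd : ∀ a, (σ ^ Nat.find (hex a)) (ρ a) = a := fun a => Nat.find_spec (hex a)
  have hρρ : ∀ a, ρ (ρ a) = ρ a := fun a => hρe _ _ (hρs a)
  have hρσ : ∀ a, ρ (σ a) = ρ a := fun a => hρe _ _ (sameCycle_apply_left.2 (SameCycle.refl _ _))
  refine ⟨ρ, fun a => Nat.find (hex a), hρs, hρe, ?_, ?_, ?_, ?_⟩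
  · intro a
    rw [Nat.find_eq_zero, hρρ]
    simp
  · intro a ha
    apply le_antisymm
    · apply Nat.find_min'
      rw [hρσ, pow_succ', mul_apply, hd]
    · have h1 := hd (σ a)
      rcases hi : Nat.find (hex (σ a)) with _ | j
      · rw [hi, hρσ] at h1
        exact absurd h1.symm ha
      · rw [hi, hρσ, pow_succ', mul_apply] at h1
        have h2 : (σ ^ j) (ρ a) = a := σ.injective h1
        exact (Nat.succ_le_succ (Nat.find_min' (hex a) h2)).trans_eq hi.symm
  · intro a b h1 h2
    have h3 : Nat.find (hex a) = Nat.find (hex b) := h2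
    calc a = (σ ^ Nat.find (hex a)) (ρ a) := (hd a).symm
      _ = (σ ^ Nat.find (hex b)) (ρ b) := by rw [h3, h1]
      _ = b := hd b
  · intro a b hab ha
    have : a = v (Quotient.mk (SameCycle.setoid σ) a) := σ.injective ha
    rw [this]
    exact hvmax _ _ ((hsame _ _).1 hab.symm)

/-- A numbering of a finite type by consecutive integers that increases by one along the cycles of
`σ`, except for one step on each cycle, which leaves a point where `w` is maximal. -/
theorem exists_cyclic_numbering {A : Type*} [Fintype A] (σ : Perm A) (w : A → ℤ) :
    ∃ (ρ : A → A) (π : A → ℕ), (∀ a, σ.SameCycle (ρ a) a) ∧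
      (∀ a b, σ.SameCycle a b → ρ a = ρ b) ∧ Function.Injective π ∧
      (∀ a, π a < Fintype.card A) ∧ (∀ a, σ a ≠ ρ a → π (σ a) = π a + 1) ∧
      (∀ a b, σ.SameCycle a b → σ a = ρ a → w b ≤ w a) := by
  classical
  obtain ⟨ρ, d, h1, h2, h3, h4, h5, h6⟩ := exists_cycle_coordinates σ w
  let e := Fintype.equivFin A
  set N := ∑ a, d a + 1 with hN
  have hdN : ∀ a, d a < N := fun a =>
    Nat.lt_succ_of_le (single_le_sum (fun _ _ => Nat.zero_le _) (mem_univ a))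
  have hNpos : 0 < N := Nat.succ_pos _
  -- As `d < N`, orbits occupy disjoint blocks of keys. Ranking removes the gaps between blocks and
  -- keeps consecutive keys consecutive.
  set key : A → ℕ := fun a => d a + N * (e (ρ a) : ℕ) with hkey
  have hinj : Function.Injective key := by
    intro a b h
    have hm : d a = d b := by
      have := congrArg (· % N) h
      simpa [hkey, Nat.add_mul_mod_self_left, Nat.mod_eq_of_lt, hdN] using this
    have hq : N * (e (ρ a) : ℕ) = N * (e (ρ b) : ℕ) := by
      simp only [hkey, hm] at h; omega
    have := e.injective (Fin.ext (Nat.eq_of_mul_eq_mul_left hNpos hq))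
    exact h5 a b this hm
  refine ⟨ρ, keyRank key, h1, h2, keyRank_injective hinj, keyRank_lt_card, fun a ha => ?_, h6⟩
  apply keyRank_eq_succ hinj
  have : ρ (σ a) = ρ a := h2 _ _ (sameCycle_apply_left.2 (SameCycle.refl _ _))
  simp only [hkey, this, h4 a ha]
  omega

end Equiv.Perm

/-! ### Numberings with small total decrease on a given set -/

/-- Every `s`-element part of `Z` has `D`-sum at least `-s (|Z| - s)`. -/
def SumsBalanced {A : Type*} (Z : Finset A) (D : A → ℤ) : Prop :=
  ∀ S ⊆ Z, -((#S : ℤ) * (#Z - #S)) ≤ ∑ a ∈ S, D a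

/-- Here `δ` is the increment along one cycle `C`, and `v` is the point where the numbering drops.
Only sets `S` containing `v` can lose, and they lose `t = #(C \ S)`. As `D` is at most `D v` on `C`,
the bounds for `S ∪ C` and `S.erase v`, with weights `1` and `t`, give exactly the bound for `S`. -/
theorem SumsBalanced.add {A : Type*} [DecidableEq A] {Z C : Finset A} {D δ : A → ℤ} {v : A}
    (hD : SumsBalanced Z D) (hoff : ∀ a ∉ C, δ a = 0)
    (hone : ∀ a ∈ C, a ≠ v → δ a = 1) (hsum : ∑ a ∈ C, δ a = 0)
    (hvZ : v ∈ Z → C ⊆ Z ∧ ∀ a ∈ C, D a ≤ D v) : SumsBalanced Z (fun a => D a + δ a) := by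
  intro S hS
  rw [sum_add_distrib]
  by_cases hvS : v ∈ S
  · obtain ⟨hCZ, hmax⟩ := hvZ (hS hvS)
    set T := C \ S with hT
    have hTv : ∑ a ∈ T, δ a = #T := by
      rw [sum_congr rfl (g := fun _ => (1 : ℤ))]
      · simp
      · intro a ha
        rw [hT, mem_sdiff] at ha
        exact hone a ha.1 (fun h => ha.2 (h ▸ hvS))
    have hSC : ∑ a ∈ S, δ a = ∑ a ∈ C ∩ S, δ a := by
      symm
      apply sum_subset inter_subset_right
      intro a ha hn
      exact hoff a (fun h => hn (mem_inter.2 ⟨h, ha⟩))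
    have hδ : ∑ a ∈ S, δ a = -#T := by
      have := sum_inter_add_sum_sdiff C S δ
      rw [hsum, ← hT, hTv] at this
      rw [hSC]; linarith
    have hdisj : Disjoint S T := disjoint_sdiff
    have h1 := hD (S ∪ T) (union_subset hS (sdiff_subset.trans hCZ))
    rw [sum_union hdisj, card_union_of_disjoint hdisj] at h1
    have h2 : ∑ a ∈ T, D a ≤ #T * D v := by
      have := sum_le_card_nsmul T D (D v) (fun a ha => hmax a (mem_sdiff.1 ha).1)
      simpa using this
    have h3 := hD (S.erase v) ((erase_subset _ _).trans hS)
    have h4 := add_sum_erase S D hvS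
    have h5 : (#(S.erase v) : ℤ) = #S - 1 := by
      have := card_erase_add_one hvS
      omega
    rw [h5] at h3
    push_cast at h1
    rw [hδ]
    have ht : (0 : ℤ) ≤ #T := Int.natCast_nonneg _
    generalize (#T : ℤ) = t at *
    generalize (#S : ℤ) = s at *
    generalize (#Z : ℤ) = c at *
    generalize ∑ a ∈ S, D a = x at *
    generalize ∑ a ∈ T, D a = y at *
    generalize ∑ a ∈ S.erase v, D a = z at *
    have h6 : t * (-((s - 1) * (c - (s - 1)))) ≤ t * z := mul_le_mul_of_nonneg_left h3 ht
    -- With `D v = x - z`, the bounds on `x + y` and `t * z` add up to a bound on `(t + 1) * x`,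
    -- because `y ≤ t * (x - z)`.
    have h7 : (t + 1) * (-(s * (c - s))) ≤ (t + 1) * (x + -t) := by
      subst h4
      linarith
    exact le_of_mul_le_mul_left h7 (by linarith)
  · have : 0 ≤ ∑ a ∈ S, δ a := by
      apply sum_nonneg
      intro a ha
      by_cases haC : a ∈ C
      · rw [hone a haC (fun h => hvS (h ▸ ha))]; norm_num
      · rw [hoff a haC]
    linarith [hD S hS]

/-- Cycles are disjoint, so their increments can be added one cycle at a time. Each cycle drops at a
point outside `Z` if it has one, and otherwise where `D` is maximal. -/
theorem SumsBalanced.exists_numbering {A : Type*} [Fintype A] {Z : Finset A} {D : A → ℤ}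
    (hD : SumsBalanced Z D) (σ : Equiv.Perm A) :
    ∃ π : A → ℕ, Function.Injective π ∧ (∀ a, π a < Fintype.card A) ∧
      SumsBalanced Z (fun a => D a + ((π (σ a) : ℤ) - π a)) := by
  classical
  -- A weight above all values of `D`, so that points outside `Z` are preferred as drop points.
  set M : ℤ := 1 + ∑ a, |D a| with hM
  have hDM : ∀ a, D a < M := fun a => by
    have := single_le_sum (fun b _ => abs_nonneg (D b)) (mem_univ a)
    have := le_abs_self (D a)
    simp only [hM]
    linarith
  obtain ⟨ρ, π, h1, h2, hinj, hlt, h4, h5⟩ :=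
    σ.exists_cyclic_numbering (fun a => if a ∈ Z then D a else M)
  refine ⟨π, hinj, hlt, ?_⟩
  have hρσ : ∀ a, ρ (σ a) = ρ a := fun a =>
    h2 _ _ (Equiv.Perm.sameCycle_apply_left.2 (Equiv.Perm.SameCycle.refl _ _))
  have hρρ : ∀ a, ρ (ρ a) = ρ a := fun a => h2 _ _ (h1 a)
  -- `Q` collects the roots of the cycles already treated; an element that is no root adds nothing.
  have key : ∀ Q : Finset A,
      SumsBalanced Z (fun a => D a + if ρ a ∈ Q then ((π (σ a) : ℤ) - π a) else 0) := by
    intro Q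
    induction Q using Finset.induction_on with
    | empty => simpa using hD
    | insert r Q hr ih =>
      by_cases hroot : ρ r = r
      · have hfun : (fun a => D a + if ρ a ∈ insert r Q then ((π (σ a) : ℤ) - π a) else 0) =
            fun a => (D a + if ρ a ∈ Q then ((π (σ a) : ℤ) - π a) else 0) +
              if ρ a = r then ((π (σ a) : ℤ) - π a) else 0 := by
          funext a
          by_cases ha : ρ a = r
          · simp [ha, hr]
          · simp [ha]
        rw [hfun]
        set C : Finset A := {a | ρ a = r} with hC
        have hmC : ∀ a, a ∈ C ↔ ρ a = r := fun a => by simp [hC]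
        have hv : ρ (σ.symm r) = r := by
          have := hρσ (σ.symm r)
          rw [Equiv.apply_symm_apply, hroot] at this
          exact this.symm
        apply SumsBalanced.add ih (C := C) (v := σ.symm r)
        · intro a ha
          rw [if_neg (fun h => ha ((hmC a).2 h))]
        · intro a ha hne
          rw [if_pos ((hmC a).1 ha), h4]
          · push_cast; ring
          · rw [(hmC a).1 ha]
            intro h
            exact hne (by rw [← h, Equiv.symm_apply_apply])
        · rw [sum_congr rfl (g := fun a => (π (σ a) : ℤ) - π a)
            (fun a ha => if_pos ((hmC a).1 ha)), sum_sub_distrib, sub_eq_zero]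
          refine sum_bij (fun a _ => σ a) (fun a ha => ?_) (fun a _ b _ h => σ.injective h)
            (fun b hb => ⟨σ.symm b, ?_, by simp⟩) (fun a _ => rfl)
          · rw [hmC, hρσ]; exact (hmC a).1 ha
          · have := hρσ (σ.symm b)
            rw [Equiv.apply_symm_apply] at this
            rw [hmC, ← this]; exact (hmC b).1 hb
        · intro hvZ
          have hmax : ∀ a ∈ C, (if a ∈ Z then D a else M) ≤ D (σ.symm r) := by
            intro a ha
            have hsc : σ.SameCycle (σ.symm r) a := by
              have h6 := h1 (σ.symm r)
              have h7 := h1 a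
              rw [hv] at h6
              rw [(hmC a).1 ha] at h7
              exact h6.symm.trans h7
            have := h5 (σ.symm r) a hsc (by rw [Equiv.apply_symm_apply, hv])
            simpa [hvZ] using this
          refine ⟨fun a ha => ?_, fun a ha => ?_⟩
          · by_contra hn
            have := hmax a ha
            rw [if_neg hn] at this
            exact absurd this (hDM _).not_ge
          · have h6 := hmax a ha
            simp only [(hmC a).1 ha, hv, hr, if_false, add_zero]
            split_ifs at h6 with h7
            · exact h6
            · exact absurd h6 (hDM _).not_ge
      · have hfun : (fun a => D a + if ρ a ∈ insert r Q then ((π (σ a) : ℤ) - π a) else 0) =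
            fun a => D a + if ρ a ∈ Q then ((π (σ a) : ℤ) - π a) else 0 := by
          funext a
          have ha : ρ a ≠ r := fun h => hroot (by rw [← h, hρρ])
          simp [ha]
        rw [hfun]
        exact ih
  simpa using key univ

/-- For several permutations at once, numberings whose total increase along the permutations is
bounded below on `Z`. -/
theorem exists_numberings_of_perms {A ι : Type*} [Fintype A] (Z : Finset A) (I : Finset ι)
    (σ : ι → Equiv.Perm A) :
    ∃ π : ι → A → ℕ, (∀ i, Function.Injective (π i)) ∧ (∀ i a, π i a < Fintype.card A) ∧
      ∀ a ∈ Z, -((#Z : ℤ) - 1) ≤ ∑ i ∈ I, ((π i (σ i a) : ℤ) - π i a) := by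
  classical
  -- Singletons `S` give the required bound. The statement for all `S` is what survives the
  -- induction on `I`.
  suffices H : ∃ π : ι → A → ℕ, (∀ i, Function.Injective (π i)) ∧
      (∀ i a, π i a < Fintype.card A) ∧
      SumsBalanced Z (fun a => ∑ i ∈ I, ((π i (σ i a) : ℤ) - π i a)) by
    obtain ⟨π, h1, h2, h3⟩ := H
    refine ⟨π, h1, h2, fun a ha => ?_⟩
    simpa using h3 {a} (by simpa using ha)
  induction I using Finset.induction_on with
  | empty =>
    refine ⟨fun _ a => Fintype.equivFin A a,
      fun _ a b h => (Fintype.equivFin A).injective (Fin.ext h), fun _ a => Fin.is_lt _, ?_⟩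
    intro S hS
    have : (#S : ℤ) ≤ #Z := by exact_mod_cast card_le_card hS
    simp only [sum_empty, sum_const_zero, Left.neg_nonpos_iff]
    exact mul_nonneg (Int.natCast_nonneg _) (by linarith)
  | insert j I hj ih =>
    obtain ⟨π, h1, h2, h3⟩ := ih
    obtain ⟨p, hp1, hp2, hp3⟩ := h3.exists_numbering (σ j)
    refine ⟨Function.update π j p, fun i => ?_, fun i a => ?_, ?_⟩
    · by_cases h : i = j
      · subst h; simpa using hp1
      · simpa [h] using h1 i
    · by_cases h : i = j
      · subst h; simpa using hp2 a
      · simpa [h] using h2 i a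
    · convert hp3 using 2 with a
      rw [sum_insert hj, add_comm, Function.update_self]
      congr 1
      apply sum_congr rfl
      intro i hi
      have : i ≠ j := fun h => hj (h ▸ hi)
      simp [this]

/-! ### Long steps and alternating signs for pair 0 -/

/-- A numbering in which the step from `τ⁻¹ r` to `r`, for `r ∈ R`, is as long as possible. -/
theorem exists_numbering_of_disjoint {A : Type*} [Fintype A] [DecidableEq A] (τ : Equiv.Perm A)
    (R : Finset A) (hR : ∀ a, τ a ∈ R → a ∉ R) :
    ∃ π : A → ℕ, Function.Injective π ∧ (∀ a, π a < Fintype.card A) ∧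
      ∀ a, τ a ∈ R → π (τ a) = π a + (Fintype.card A - #R) := by
  set n := Fintype.card A with hn
  let e : A → ℕ := fun a => Fintype.equivFin A a
  have he : Function.Injective e := fun a b h => (Fintype.equivFin A).injective (Fin.ext h)
  have hen : ∀ a, e a < n := fun a => Fin.is_lt _
  -- Three blocks: the preimages of `R`, then the rest, then `R`. The first and last are ordered
  -- alike, so each `a` with `τ a ∈ R` has the same position in its block as `τ a`.
  set key : A → ℕ := fun a => if τ a ∈ R then e (τ a) else if a ∈ R then 2 * n + e a else n + e a
    with hkey
  have k1 : ∀ a, τ a ∈ R → key a = e (τ a) := fun a h => by simp [hkey, h]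
  have k2 : ∀ a, a ∈ R → key a = 2 * n + e a := fun a h => by
    have : τ a ∉ R := fun h' => hR a h' h
    simp [hkey, h, this]
  have k3 : ∀ a, τ a ∉ R → a ∉ R → key a = n + e a := fun a h h' => by simp [hkey, h, h']
  have hinj : Function.Injective key := by
    intro a b h
    have ha := hen a
    have hb := hen b
    have hta := hen (τ a)
    have htb := hen (τ b)
    simp only [hkey] at h
    split_ifs at h
    · exact τ.injective (he h)
    all_goals first
      | (exfalso; omega)
      | exact he (by omega)
  refine ⟨keyRank key, keyRank_injective hinj, keyRank_lt_card, fun a ha => ?_⟩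
  have hlow : keyRank key a = #{r ∈ R | e r < e (τ a)} := by
    rw [keyRank]
    apply card_bij (fun x _ => τ x)
    · intro x hx
      simp only [mem_filter, mem_univ, true_and, k1 a ha] at hx
      have h1 := hen (τ a)
      by_cases hxR : τ x ∈ R
      · rw [k1 x hxR] at hx
        exact mem_filter.2 ⟨hxR, hx⟩
      · exfalso
        by_cases hxR' : x ∈ R
        · rw [k2 x hxR'] at hx; omega
        · rw [k3 x hxR hxR'] at hx; omega
    · intro x _ y _ h
      exact τ.injective h
    · intro r hr
      rw [mem_filter] at hr
      refine ⟨τ.symm r, ?_, by simp⟩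
      simp only [mem_filter, mem_univ, true_and, k1 a ha]
      rw [k1 _ (by simpa using hr.1)]
      simpa using hr.2
  have hhigh : keyRank key (τ a) = #Rᶜ + #{r ∈ R | e r < e (τ a)} := by
    rw [keyRank, ← card_union_of_disjoint
      (disjoint_compl_left.mono_right (filter_subset _ _))]
    congr 1
    ext x
    simp only [mem_filter, mem_univ, true_and, mem_union, mem_compl, k2 _ ha]
    by_cases hxR : x ∈ R
    · simp [hxR, k2 x hxR]
    · simp only [hxR, not_false_eq_true, true_or, iff_true]
      by_cases hxR' : τ x ∈ R
      · rw [k1 x hxR']; have := hen (τ x); omega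
      · rw [k3 x hxR' hxR]; have := hen x; omega
  rw [hhigh, hlow, card_compl, ← hn]
  omega

/-- Two-colour a fixed-point-free permutation so that it alternates except at one step on each
odd cycle. -/
theorem exists_alternating {A : Type*} [Fintype A] [DecidableEq A] (τ : Equiv.Perm A)
    (hτ : ∀ a, τ a ≠ a) :
    ∃ (R : Finset A) (ε : A → Bool), 3 * #R ≤ Fintype.card A ∧ (∀ a, τ a ∈ R → a ∉ R) ∧
      (∀ a, τ a ∉ R → ε (τ a) = !ε a) ∧ ∀ a, τ a ∈ R → ε (τ a) = true ∧ ε a = true := by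
  obtain ⟨ρ, d, h1, h2, h3, h4, h5, -⟩ := τ.exists_cycle_coordinates (fun _ => 0)
  have hρτ : ∀ a, ρ (τ a) = ρ a := fun a =>
    h2 _ _ (Equiv.Perm.sameCycle_apply_left.2 (Equiv.Perm.SameCycle.refl _ _))
  have hρρ : ∀ a, ρ (ρ a) = ρ a := fun a => h2 _ _ (h1 a)
  have hd0 : ∀ a, d a = 0 → ρ a = a := fun a h => h5 _ _ (hρρ a) (by rw [h3, h])
  -- `d (τ.symm r)` is the last index on the cycle of the root `r`; it is even exactly when the
  -- cycle is odd.
  set R : Finset A := {r | ρ r = r ∧ Even (d (τ.symm r))} with hRdef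
  have hR : ∀ r, r ∈ R ↔ ρ r = r ∧ Even (d (τ.symm r)) := fun r => by simp [hRdef]
  have hτR : ∀ a, τ a ∈ R ↔ τ a = ρ a ∧ Even (d a) := fun a => by
    rw [hR, hρτ, Equiv.symm_apply_apply, eq_comm]
  have hzero : ∀ r ∈ R, d r = 0 := fun r hr => by
    have := h3 r
    rwa [((hR r).1 hr).1] at this
  have hlast : ∀ a, τ a ∈ R → d a ≠ 0 := fun a ha h => by
    rw [hτR, hd0 a h] at ha
    exact hτ a ha.1
  have hfirst : ∀ r ∈ R, d (τ r) = 1 := fun r hr => by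
    rw [h4, hzero r hr]
    rw [((hR r).1 hr).1]
    exact hτ r
  refine ⟨R, fun a => decide (Even (d a)), ?_, fun a ha ha' => hlast a ha (hzero a ha'), ?_, ?_⟩
  -- An odd cycle without fixed points has length at least 3, so `R`, `τ R` and `τ⁻¹ R` are pairwise
  -- disjoint.
  · have hc1 : #(R.image τ) = #R := card_image_of_injective _ τ.injective
    have hc2 : #(R.image τ.symm) = #R := card_image_of_injective _ τ.symm.injective
    have hd1 : Disjoint R (R.image τ) := by
      rw [disjoint_left]
      intro a ha hb
      obtain ⟨r, hr, rfl⟩ := mem_image.1 hb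
      have := hzero _ ha
      rw [hfirst r hr] at this
      omega
    have hmem : ∀ a ∈ R.image τ.symm, τ a ∈ R := by
      intro a ha
      obtain ⟨r, hr, rfl⟩ := mem_image.1 ha
      simpa using hr
    have hd2 : Disjoint (R ∪ R.image τ) (R.image τ.symm) := by
      rw [disjoint_left]
      intro a ha hb
      have hb' := hmem a hb
      rcases mem_union.1 ha with h | h
      · exact hlast a hb' (hzero a h)
      · obtain ⟨r, hr, rfl⟩ := mem_image.1 h
        have := ((hτR _).1 hb').2
        rw [hfirst r hr] at this
        exact absurd this (by decide)
    have := card_le_univ ((R ∪ R.image τ) ∪ R.image τ.symm)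
    rw [card_union_of_disjoint hd2, card_union_of_disjoint hd1, hc1, hc2] at this
    omega
  · intro a ha
    by_cases h : τ a = ρ a
    · have h6 : ¬ Even (d a) := fun h' => ha ((hτR a).2 ⟨h, h'⟩)
      have h7 : d (τ a) = 0 := by rw [h, h3]
      simp [h6, h7]
    · simp [h4 a h, Nat.even_add_one, -Nat.not_even_iff_odd]
  · intro a ha
    have := (hτR a).1 ha
    have h7 : d (τ a) = 0 := hzero _ ha
    simp [h7, this.2]

/-! ### Decomposition into perfect matchings -/

/-- **König**: a `k`-regular bipartite relation is a disjoint union of `k` bijections. -/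
theorem exists_equivs_of_regular {A B : Type*} [Fintype A] [Fintype B] [DecidableEq A]
    [DecidableEq B] (k : ℕ) (N : B → Finset A) (hB : ∀ b, #(N b) = k)
    (hA : ∀ a, #{b | a ∈ N b} = k) (hcard : Fintype.card B = Fintype.card A) :
    ∃ m : Fin k → B ≃ A, (∀ i j b, m i b = m j b → i = j) ∧
      ∀ b a, a ∈ N b ↔ ∃ i, m i b = a := by
  induction k generalizing N with
  | zero =>
    refine ⟨fun i => i.elim0, fun i => i.elim0, fun b a => ?_⟩
    simp [card_eq_zero.1 (hB b)]
  | succ k ih =>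
    -- Hall's condition, by counting the incidences between `S` and its neighbours.
    have hall : ∀ S : Finset B, #S ≤ #(S.biUnion N) := by
      intro S
      have := card_mul_le_card_mul (s := S) (t := S.biUnion N) (fun b a => a ∈ N b)
        (m := k + 1) (n := k + 1) ?_ ?_
      · exact Nat.le_of_mul_le_mul_right this k.succ_pos
      · intro b hb
        rw [← hB b]
        apply card_le_card
        intro a ha
        exact (mem_bipartiteAbove _).2 ⟨mem_biUnion.2 ⟨b, hb, ha⟩, ha⟩
      · intro a _
        rw [← hA a]
        apply card_le_card
        intro b hb
        simpa using ((mem_bipartiteBelow _).1 hb).2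
    obtain ⟨f, hf, hfN⟩ := (all_card_le_biUnion_card_iff_exists_injective N).1 hall
    have hbij := (Fintype.bijective_iff_injective_and_card f).2 ⟨hf, hcard⟩
    let g := Equiv.ofBijective f hbij
    have hg : ∀ b, g b ∈ N b := hfN
    obtain ⟨m, hm1, hm2⟩ := ih (fun b => (N b).erase (g b))
      (fun b => by rw [card_erase_of_mem (hg b), hB]; rfl)
      (fun a => by
        have : ({b | a ∈ (N b).erase (g b)} : Finset B) =
            ({b | a ∈ N b} : Finset B).erase (g.symm a) := by
          ext b
          simp only [mem_filter, mem_univ, true_and, mem_erase, ne_eq, Equiv.eq_symm_apply]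
          rw [eq_comm]
        rw [this, card_erase_of_mem, hA]
        · rfl
        · have := hg (g.symm a)
          simpa using this)
    have hne : ∀ i b, m i b ≠ g b := fun i b h =>
      (mem_erase.1 ((hm2 b (m i b)).2 ⟨i, rfl⟩)).1 h
    refine ⟨Fin.cons g m, fun i j b => ?_, fun b a => ?_⟩
    · refine Fin.cases ?_ (fun i => ?_) i <;> refine Fin.cases ?_ (fun j => ?_) j
      · simp
      · intro h
        exact absurd h.symm (by simpa using hne j b)
      · intro h
        exact absurd h (by simpa using hne i b)
      · intro h
        exact congrArg Fin.succ (hm1 i j b (by simpa using h))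
    · rw [Fin.exists_fin_succ]
      simp only [Fin.cons_zero, Fin.cons_succ, ← hm2, mem_erase]
      constructor
      · intro h
        by_cases h' : g b = a
        · exact Or.inl h'
        · exact Or.inr ⟨fun h'' => h' h''.symm, h⟩
      · rintro (h | h)
        · exact h ▸ hg b
        · exact h.2

/-! ### Labels of the paired matchings -/

/-- The labels of two matchings whose labels at every `a` add up to `k * n`. -/
def pairLabel {A : Type*} (k n : ℤ) {l : ℕ} (ε : Fin l → A → Bool) (π : Fin l → A → ℕ)
    (p : Fin l × Bool) (a : A) : ℤ :=
  if p.2 = ε p.1 a then k * π p.1 a + (p.1 + 1) else k * n - (k * π p.1 a + (p.1 + 1))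

section pairLabel

variable {A : Type*} {k n : ℤ} {l : ℕ} {ε : Fin l → A → Bool} {π : Fin l → A → ℕ}

theorem pairLabel_add (r : Fin l) (a : A) :
    pairLabel k n ε π (r, true) a + pairLabel k n ε π (r, false) a = k * n := by
  cases h : ε r a <;> simp [pairLabel, h]

theorem pairLabel_pos (hk : 2 * (l : ℤ) < k) (hπn : ∀ r a, (π r a : ℤ) < n) (p : Fin l × Bool)
    (a : A) : 0 < pairLabel k n ε π p a := by
  have h1 : (p.1 : ℤ) + 1 ≤ l := by exact_mod_cast p.1.is_lt
  have h2 : (0 : ℤ) ≤ p.1 := Int.natCast_nonneg _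
  have h3 : (0 : ℤ) ≤ k * π p.1 a := mul_nonneg (by linarith) (Int.natCast_nonneg _)
  have h4 : k * ((π p.1 a : ℤ) + 1) ≤ k * n := mul_le_mul_of_nonneg_left (hπn p.1 a) (by linarith)
  rw [pairLabel]
  split_ifs <;> linarith

theorem pairLabel_lt (hk : 2 * (l : ℤ) < k) (hπn : ∀ r a, (π r a : ℤ) < n) (p : Fin l × Bool)
    (a : A) : pairLabel k n ε π p a < k * n := by
  have h1 := pairLabel_add (k := k) (n := n) (ε := ε) (π := π) p.1 a
  have h2 := pairLabel_pos (ε := ε) hk hπn (p.1, true) a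
  have h3 := pairLabel_pos (ε := ε) hk hπn (p.1, false) a
  obtain ⟨r, _ | _⟩ := p <;> simp only at * <;> linarith

theorem not_dvd_pairLabel (hk : 2 * (l : ℤ) < k) (p : Fin l × Bool) (a : A) :
    ¬ k ∣ pairLabel k n ε π p a := by
  have h1 : (p.1 : ℤ) + 1 ≤ l := by exact_mod_cast p.1.is_lt
  have h2 : (0 : ℤ) ≤ p.1 := Int.natCast_nonneg _
  intro h
  have h3 : k ∣ (p.1 : ℤ) + 1 := by
    rw [pairLabel] at h
    split_ifs at h
    · exact (dvd_add_right (dvd_mul_right _ _)).1 h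
    · exact (dvd_add_right (dvd_mul_right _ _)).1 ((dvd_sub_right (dvd_mul_right _ _)).1 h)
  have := Int.le_of_dvd (by linarith) h3
  linarith

/-- As `2 * l < k`, the residues `±(r + 1)` with `r < l` are pairwise distinct mod `k`. So the
residue gives the pair and the sign, and the quotient then gives `a`. -/
theorem pairLabel_inj (hk : 2 * (l : ℤ) < k) (hπ : ∀ r, Function.Injective (π r))
    {p p' : Fin l × Bool} {a a' : A} (h : pairLabel k n ε π p a = pairLabel k n ε π p' a') :
    p = p' ∧ a = a' := by
  have h1 : (p.1 : ℤ) + 1 ≤ l := by exact_mod_cast p.1.is_lt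
  have h2 : (0 : ℤ) ≤ p.1 := Int.natCast_nonneg _
  have h1' : (p'.1 : ℤ) + 1 ≤ l := by exact_mod_cast p'.1.is_lt
  have h2' : (0 : ℤ) ≤ p'.1 := Int.natCast_nonneg _
  have opp : ∀ x y : ℤ, k * x + (p.1 + 1) = k * n - (k * y + (p'.1 + 1)) → False := by
    intro x y hxy
    have hd : k ∣ (p.1 : ℤ) + 1 + (p'.1 + 1) := ⟨n - x - y, by linarith⟩
    have := Int.le_of_dvd (by linarith) hd
    linarith
  have same : k * (π p.1 a : ℤ) + (p.1 + 1) = k * π p'.1 a' + (p'.1 + 1) →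
      p.1 = p'.1 ∧ a = a' := by
    intro hxy
    have hd : k ∣ (p.1 : ℤ) - p'.1 := ⟨π p'.1 a' - π p.1 a, by linarith⟩
    have h3 := Int.eq_zero_of_abs_lt_dvd hd (abs_lt.2 ⟨by linarith, by linarith⟩)
    have h4 : p.1 = p'.1 := Fin.ext (by omega)
    rw [h4, add_left_inj] at hxy
    have h5 : (π p'.1 a : ℤ) = π p'.1 a' := mul_left_cancel₀ (by linarith) hxy
    exact ⟨h4, hπ _ (by exact_mod_cast h5)⟩
  rw [pairLabel, pairLabel] at h
  split_ifs at h with c1 c2 c2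
  · obtain ⟨h3, h4⟩ := same h
    exact ⟨Prod.ext h3 (by rw [c1, c2, h3, h4]), h4⟩
  · exact (opp _ _ h).elim
  · exact (opp (π p.1 a) (π p'.1 a') (by linarith)).elim
  · obtain ⟨h3, h4⟩ := same (by linarith)
    refine ⟨Prod.ext h3 ?_, h4⟩
    rw [h3, h4] at c1
    revert c1 c2
    cases p.2 <;> cases p'.2 <;> cases ε p'.1 a' <;> simp

end pairLabel

/-! ### The labeling of a union of matchings -/

/-- A numbering of a finite type that puts the elements of `Z` last and is otherwise sorted by
`W`. -/
theorem exists_sorted_numbering {B : Type*} [Fintype B] [DecidableEq B] (Z : Finset B)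
    (W : B → ℤ) :
    ∃ μ : B → ℕ, Function.Injective μ ∧ (∀ b, μ b < Fintype.card B) ∧
      (∀ b b', (b ∈ Z ↔ b' ∈ Z) → μ b < μ b' → W b ≤ W b') ∧
      ∀ b ∈ Z, Fintype.card B - #Z ≤ μ b := by
  -- `false < true` puts `Z` last; the final coordinate only breaks ties.
  let key : B → Bool ×ₗ (ℤ ×ₗ Fin (Fintype.card B)) := fun b =>
    toLex (decide (b ∈ Z), toLex (W b, Fintype.equivFin B b))
  have hinj : Function.Injective key := by
    intro b b' h
    have h1 := congrArg (fun x => (ofLex (ofLex x).2).2) h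
    exact (Fintype.equivFin B).injective h1
  refine ⟨keyRank key, keyRank_injective hinj, keyRank_lt_card, fun b b' hb h => ?_,
    fun b hb => ?_⟩
  · have h1 := key_le_of_keyRank_lt h
    simp only [key, Prod.Lex.toLex_le_toLex, hb, lt_self_iff_false, false_or, true_and] at h1
    rcases h1 with h1 | h1
    · exact h1.le
    · exact h1.1.le
  · rw [← card_compl]
    apply card_le_card
    intro x hx
    rw [mem_compl] at hx
    simp [key, Prod.Lex.toLex_lt_toLex, hx, hb]

/-- An antimagic labeling of the union of `2 * q + 3` disjoint perfect matchings, one of them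
distinguished and the others grouped in pairs. Here `lab i a` is the label of the edge of the
matching `m i` at `a`. -/
theorem exists_antimagic_labels {A B : Type*} [Fintype A] [Fintype B] [DecidableEq A]
    [DecidableEq B] (q : ℕ) (m : Option (Fin (q + 1) × Bool) → B ≃ A)
    (hm : ∀ i j b, m i b = m j b → i = j) :
    ∃ lab : Option (Fin (q + 1) × Bool) → A → ℤ,
      (∀ i a, 1 ≤ lab i a ∧ lab i a ≤ (2 * q + 3) * Fintype.card A) ∧
      (∀ i i' a a', lab i a = lab i' a' → i = i' ∧ a = a') ∧
      Function.Injective (Sum.elim (fun b => ∑ i, lab i (m i b)) (fun a => ∑ i, lab i a)) := by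
  set n := Fintype.card A with hn
  have hcard : Fintype.card B = n := Fintype.card_congr (m none)
  set k : ℤ := 2 * q + 3 with hk
  have hkpos : 0 < k := by positivity
  have hlk : 2 * ((q + 1 : ℕ) : ℤ) < k := by push_cast; linarith
  -- Each step of `τ` passes through one vertex `b`, from its neighbour in `(0, false)` to its
  -- neighbour in `(0, true)`.
  let τ : Equiv.Perm A := (m (some (0, false))).symm.trans (m (some (0, true)))
  have hτ : ∀ a, τ a ≠ a := by
    intro a h
    have h1 : m (some (0, true)) ((m (some (0, false))).symm a) =
        m (some (0, false)) ((m (some (0, false))).symm a) := by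
      rw [Equiv.apply_symm_apply]; exact h
    simpa using hm _ _ _ h1
  have hτm : ∀ b, τ (m (some (0, false)) b) = m (some (0, true)) b := fun b => by simp [τ]
  obtain ⟨R, ε₀, hRcard, hRdisj, hgood, hbad⟩ := exists_alternating τ hτ
  obtain ⟨π₀, hπ₀, hπ₀n, hπ₀R⟩ := exists_numbering_of_disjoint τ R hRdisj
  set Z : Finset B := {b | m (some (0, true)) b ∈ R} with hZdef
  have hZ : ∀ b, b ∈ Z ↔ m (some (0, true)) b ∈ R := fun b => by simp [hZdef]
  have hZR : #Z = #R := by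
    apply card_bij (fun b _ => m (some (0, true)) b)
    · intro b hb; exact (hZ b).1 hb
    · intro b _ b' _ h; exact (m _).injective h
    · intro a ha; exact ⟨(m (some (0, true))).symm a, by simpa [hZ] using ha, by simp⟩
  obtain ⟨p, hp, hpn, hpZ⟩ := exists_numberings_of_perms Z univ
    (fun i : Fin q => (m (some (i.succ, true))).trans (m (some (i.succ, false))).symm)
  let ε : Fin (q + 1) → A → Bool := Fin.cons ε₀ fun _ _ => true
  -- The later numberings `p i` live on `B` and are carried to `A` along the matching `(i.succ,
  -- false)`; thus pair `i.succ` contributes at `b` the increment of `p i` along its permutation.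
  let π : Fin (q + 1) → A → ℕ := Fin.cons π₀ fun i a => p i ((m (some (i.succ, false))).symm a)
  have hπ : ∀ r, Function.Injective (π r) := by
    intro r
    refine Fin.cases ?_ (fun i => ?_) r
    · exact hπ₀
    · exact (hp i).comp (Equiv.injective _)
  have hπn : ∀ r a, (π r a : ℤ) < n := by
    intro r a
    refine Fin.cases ?_ (fun i => ?_) r
    · exact_mod_cast hπ₀n a
    · have := hpn i ((m (some (i.succ, false))).symm a)
      rw [hcard] at this
      exact_mod_cast this
  let P := pairLabel k n ε π
  let D : B → ℤ := fun b => ∑ i : Fin q,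
    ((p i ((m (some (i.succ, false))).symm (m (some (i.succ, true)) b)) : ℤ) - p i b)
  let F : B → ℤ := fun b =>
    P (0, true) (m (some (0, true)) b) + P (0, false) (m (some (0, false)) b)
  let W : B → ℤ := fun b => ∑ r, P r (m (some r) b)
  have hW : ∀ b, W b = F b + (q * (k * n) + k * D b) := by
    intro b
    simp only [W, Fintype.sum_prod_type, Fintype.sum_bool, Fin.sum_univ_succ, F]
    congr 1
    have : ∀ i : Fin q, P (i.succ, true) (m (some (i.succ, true)) b) +
        P (i.succ, false) (m (some (i.succ, false)) b) = k * n + k * ((p i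
          ((m (some (i.succ, false))).symm (m (some (i.succ, true)) b)) : ℤ) - p i b) := by
      intro i
      simp [P, pairLabel, ε, π]
      ring
    rw [sum_congr rfl fun i _ => this i, sum_add_distrib, sum_const, card_univ,
      Fintype.card_fin, nsmul_eq_mul, mul_sum]
  have hPA : ∀ a, ∑ r, P r a = (q + 1) * (k * n) := by
    intro a
    simp only [Fintype.sum_prod_type, Fintype.sum_bool, P, pairLabel_add]
    simp
  have hFbad : ∀ b ∈ Z, F b = k * n + k * (n - #Z) := by
    intro b hb
    rw [hZ, ← hτm] at hb
    obtain ⟨h1, h2⟩ := hbad _ hb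
    have h3 : _ = _ + (n - #R) := hπ₀R _ hb
    have h4 : #R ≤ n := card_le_univ R
    simp only [F, ← hτm, P, pairLabel, ε, π, Fin.cons_zero, h1, h2, h3, hZR]
    push_cast [Nat.cast_sub h4]
    simp
    ring
  -- Alternation gives both labels of pair 0 at `b` the same residue, so `F b` is `2` or `-2` mod
  -- `k`, with `k ≥ 3`.
  have hFgood : ∀ b ∉ Z, ¬ k ∣ F b := by
    intro b hb
    rw [hZ, ← hτm] at hb
    have h1 := hgood _ hb
    have h2 : ¬ k ∣ 2 := fun h => by
      have := Int.le_of_dvd (by norm_num) h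
      linarith
    intro h3
    apply h2
    simp only [F, ← hτm, P, pairLabel, ε, π, Fin.cons_zero, h1] at h3
    obtain ⟨x, hx⟩ := h3
    cases h : ε₀ (m (some (0, false)) b) <;> simp [h] at hx
    · exact ⟨x - π₀ (τ (m (some (0, false)) b)) - π₀ (m (some (0, false)) b), by linarith⟩
    · exact ⟨2 * n - x - π₀ (τ (m (some (0, false)) b)) - π₀ (m (some (0, false)) b),
        by linarith⟩
  obtain ⟨μ, hμ, hμn, hμW, hμZ⟩ := exists_sorted_numbering Z W
  let lab : Option (Fin (q + 1) × Bool) → A → ℤ := fun i a =>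
    i.elim (k * (μ ((m none).symm a) + 1)) fun r => P r a
  have hμn' : ∀ b, (μ b : ℤ) + 1 ≤ n := fun b => by
    have := hμn b
    rw [hcard] at this
    exact_mod_cast this
  have hsumB : ∀ b, ∑ i, lab i (m i b) = k * (μ b + 1) + W b := by
    intro b
    rw [Fintype.sum_option]
    simp [lab, W]
  have hsumA : ∀ a, ∑ i, lab i a = k * (μ ((m none).symm a) + 1) + (q + 1) * (k * n) := by
    intro a
    rw [Fintype.sum_option, ← hPA a]
    simp [lab]
  have hdvdA : ∀ a, k ∣ ∑ i, lab i a := fun a => by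
    rw [hsumA]
    exact ⟨μ ((m none).symm a) + 1 + (q + 1) * n, by ring⟩
  have hdvdB : ∀ b, k ∣ ∑ i, lab i (m i b) ↔ b ∈ Z := by
    intro b
    have h1 : ∑ i, lab i (m i b) = F b + k * (μ b + 1 + q * n + D b) := by
      rw [hsumB, hW]; ring
    rw [h1, dvd_add_left (dvd_mul_right _ _)]
    refine ⟨fun h => ?_, fun h => ?_⟩
    · by_contra hn
      exact hFgood b hn h
    · rw [hFbad b h]
      exact ⟨n + (n - #Z), by ring⟩
  have hlt : ∀ b b', (b ∈ Z ↔ b' ∈ Z) → μ b < μ b' →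
      ∑ i, lab i (m i b) < ∑ i, lab i (m i b') := by
    intro b b' hbb h
    rw [hsumB, hsumB]
    have h1 := hμW b b' hbb h
    have h2 : k * ((μ b : ℤ) + 1) < k * (μ b' + 1) := by
      apply mul_lt_mul_of_pos_left _ hkpos
      exact_mod_cast Nat.succ_lt_succ h
    linarith
  have hBB : ∀ b b', ∑ i, lab i (m i b) = ∑ i, lab i (m i b') → b = b' := by
    intro b b' h
    have hbb : b ∈ Z ↔ b' ∈ Z := by rw [← hdvdB, ← hdvdB, h]
    rcases lt_trichotomy (μ b) (μ b') with h1 | h1 | h1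
    · exact absurd h (hlt b b' hbb h1).ne
    · exact hμ h1
    · exact absurd h (hlt b' b hbb.symm h1).ne'
  have hBA : ∀ b a, ∑ i, lab i (m i b) ≠ ∑ i, lab i a := by
    intro b a h
    have hb : b ∈ Z := by rw [← hdvdB, h]; exact hdvdA a
    rw [hsumB, hsumA, hW, hFbad b hb] at h
    -- Divided by `k`, the left side is at least `(q + 3) * n - 3 * #Z + 2 ≥ (q + 2) * n + 2`, while
    -- the right side is at most `(q + 2) * n`.
    have h1 : k * ((μ b : ℤ) + 1 + n + (n - #Z) + q * n + D b) =
        k * (μ ((m none).symm a) + 1 + (q + 1) * n) := by linarith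
    have h2 := mul_left_cancel₀ hkpos.ne' h1
    have h3 : -((#Z : ℤ) - 1) ≤ D b := hpZ b hb
    have h4 := hμZ b hb
    have h5 := hμn' ((m none).symm a)
    rw [hcard] at h4
    rw [← hn, ← hZR] at hRcard
    have h6 : (n : ℤ) - #Z ≤ μ b := by omega
    have h7 : 3 * (#Z : ℤ) ≤ n := by exact_mod_cast hRcard
    linarith
  refine ⟨lab, ?_, ?_, ?_⟩
  · rintro (_ | r) a
    · have h1 := hμn' ((m none).symm a)
      have h2 : k * ((μ ((m none).symm a) : ℤ) + 1) ≤ k * n :=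
        mul_le_mul_of_nonneg_left h1 hkpos.le
      have h3 : 0 < k * ((μ ((m none).symm a) : ℤ) + 1) := by positivity
      exact ⟨h3, h2⟩
    · exact ⟨pairLabel_pos hlk hπn r a, (pairLabel_lt hlk hπn r a).le⟩
  · rintro (_ | r) (_ | r') a a' h
    · have h1 : k * ((μ ((m none).symm a) : ℤ) + 1) = k * (μ ((m none).symm a') + 1) := h
      have h2 := mul_left_cancel₀ hkpos.ne' h1
      exact ⟨rfl, (m none).symm.injective (hμ (by omega))⟩
    · exact absurd ⟨_, h.symm⟩ (not_dvd_pairLabel (n := n) (ε := ε) (π := π) hlk r' a')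
    · exact absurd ⟨_, h⟩ (not_dvd_pairLabel (n := n) (ε := ε) (π := π) hlk r a)
    · obtain ⟨h1, h2⟩ := pairLabel_inj hlk hπ h
      exact ⟨congrArg some h1, h2⟩
  · rintro (b | a) (b' | a') h
    · exact congrArg _ (hBB b b' h)
    · exact absurd h (hBA b a')
    · exact absurd h.symm (hBA b' a)
    · have h1 : ∑ i, lab i a = ∑ i, lab i a' := h
      rw [hsumA, hsumA, add_left_inj] at h1
      have h2 := mul_left_cancel₀ hkpos.ne' h1
      exact congrArg _ ((m none).symm.injective (hμ (by omega)))

/-! ### From matchings to the graph -/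

theorem mainTheorem1 {V : Type*} [Fintype V] [DecidableEq V]
    (G : SimpleGraph V) [DecidableRel G.Adj] (hbip : G.IsBipartite)
    (k : ℕ) (hk : 2 ≤ k) (hodd : Odd k) (hreg : G.IsRegularOfDegree k) :
    G.IsAntimagic := by
  obtain ⟨C⟩ := hbip
  let A := {v : V // C v = 0}
  let B := {v : V // C v = 1}
  have hcol : ∀ v, C v = 0 ∨ C v = 1 := fun v => by
    generalize C v = x; revert x; decide
  have hAB : ∀ v w, G.Adj v w → C v = 1 → C w = 0 := fun v w h hv =>
    (hcol w).resolve_right fun hw => C.valid h (hv.trans hw.symm)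
  have hBA : ∀ v w, G.Adj v w → C v = 0 → C w = 1 := fun v w h hv =>
    (hcol w).resolve_left fun hw => C.valid h (hv.trans hw.symm)
  let N : B → Finset A := fun b => {a | G.Adj b a}
  have hN : ∀ b a, a ∈ N b ↔ G.Adj b a := fun b a => by simp [N]
  have hNB : ∀ b, #(N b) = k := by
    intro b
    rw [← hreg.degree_eq b, ← G.card_neighborFinset_eq_degree]
    apply card_bij (fun (a : A) _ => a.1)
    · intro a ha
      simpa [hN] using ha
    · intro a _ a' _ h; exact Subtype.ext h
    · intro v hv
      rw [G.mem_neighborFinset] at hv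
      exact ⟨⟨v, hAB _ _ hv b.2⟩, (hN _ _).2 hv, rfl⟩
  have hNA : ∀ a, #{b | a ∈ N b} = k := by
    intro a
    rw [← hreg.degree_eq a, ← G.card_neighborFinset_eq_degree]
    apply card_bij (fun (b : B) _ => b.1)
    · intro b hb
      simpa [hN, G.adj_comm] using hb
    · intro a _ a' _ h; exact Subtype.ext h
    · intro v hv
      rw [G.mem_neighborFinset] at hv
      refine ⟨⟨v, hBA _ _ hv a.2⟩, ?_, rfl⟩
      simpa [hN] using hv.symm
  have hcard : Fintype.card B = Fintype.card A := by
    have := card_mul_eq_card_mul (s := (univ : Finset B)) (t := (univ : Finset A))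
      (fun b a => a ∈ N b) (m := k) (n := k)
      (fun b _ => by rw [← hNB b]; congr 1; ext a; simp [mem_bipartiteAbove])
      (fun a _ => by rw [← hNA a]; rfl)
    exact Nat.eq_of_mul_eq_mul_right (by omega) this
  obtain ⟨q, hq⟩ : ∃ q, k = 2 * q + 3 := by
    obtain ⟨j, hj⟩ := hodd
    exact ⟨j - 1, by omega⟩
  obtain ⟨m₀, hm₀, hm₀N⟩ := exists_equivs_of_regular k N hNB hNA hcard
  let e : Option (Fin (q + 1) × Bool) ≃ Fin k :=
    Fintype.equivFinOfCardEq (by simp [hq]; ring)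
  let m : Option (Fin (q + 1) × Bool) → B ≃ A := fun i => m₀ (e i)
  have hm : ∀ i j b, m i b = m j b → i = j := fun i j b h => e.injective (hm₀ _ _ b h)
  have hmadj : ∀ i (b : B), G.Adj (b : V) (m i b : V) := fun i b =>
    (hN _ _).1 ((hm₀N _ _).2 ⟨e i, rfl⟩)
  have hadjm : ∀ (b : B) (a : A), G.Adj (b : V) a → ∃ i, m i b = a := fun b a h => by
    obtain ⟨j, hj⟩ := (hm₀N b a).1 ((hN _ _).2 h)
    exact ⟨e.symm j, by simpa [m] using hj⟩
  obtain ⟨lab, hlab, hlabinj, hsum⟩ := exists_antimagic_labels q m hm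
  let E : Option (Fin (q + 1) × Bool) × A → Sym2 V := fun x =>
    s(((m x.1).symm x.2 : V), (x.2 : V))
  have hne : ∀ (b : B) (a : A), (b : V) ≠ a := fun b a h => by
    have h1 := b.2
    rw [h, a.2] at h1
    exact absurd h1 (by decide)
  have hEinj : Function.Injective E := by
    rintro ⟨i, a⟩ ⟨j, a'⟩ h
    rcases Sym2.eq_iff.1 h with ⟨h1, h2⟩ | ⟨h1, -⟩
    · have h3 : a = a' := Subtype.ext h2
      subst h3
      have h4 : (m i).symm a = (m j).symm a := Subtype.ext h1
      have h5 : m i ((m i).symm a) = m j ((m i).symm a) := by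
        rw [Equiv.apply_symm_apply, h4, Equiv.apply_symm_apply]
      rw [hm i j _ h5]
    · exact absurd h1 (hne _ _)
  have hEm : ∀ i (b : B), E (i, m i b) = s((b : V), (m i b : V)) := fun i b => by simp [E]
  have hEadj : ∀ x, E x ∈ G.edgeSet := fun x => by
    have := hmadj x.1 ((m x.1).symm x.2)
    rw [Equiv.apply_symm_apply] at this
    exact this
  have hErange : ∀ v w, G.Adj v w → C v = 1 → ∃ x, E x = s(v, w) := by
    intro v w h hv
    obtain ⟨i, hi⟩ := hadjm ⟨v, hv⟩ ⟨w, hAB _ _ h hv⟩ h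
    refine ⟨(i, m i ⟨v, hv⟩), ?_⟩
    rw [hEm, hi]
  have hEsurj : ∀ s ∈ G.edgeSet, ∃ x, E x = s := by
    intro s hs
    induction s using Sym2.ind with
    | _ v w =>
      rcases hcol v with hv | hv
      · obtain ⟨x, hx⟩ := hErange w v (SimpleGraph.Adj.symm hs) (hBA _ _ hs hv)
        exact ⟨x, hx.trans Sym2.eq_swap⟩
      · exact hErange v w hs hv
  -- All labels are at least `1`, so `toNat` loses nothing; the value `0` off the edges plays no
  -- role.
  let f : Sym2 V → ℕ := Function.extend E (fun x => (lab x.1 x.2).toNat) 0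
  have hf : ∀ x, (f (E x) : ℤ) = lab x.1 x.2 := fun x => by
    simp only [f, hEinj.extend_apply]
    exact Int.toNat_of_nonneg (by linarith [(hlab x.1 x.2).1])
  have hEimage : G.edgeFinset = univ.image E := by
    ext s
    simp only [SimpleGraph.mem_edgeFinset, mem_image, mem_univ, true_and]
    refine ⟨hEsurj s, ?_⟩
    rintro ⟨x, rfl⟩
    exact hEadj x
  have hEcard : (#G.edgeFinset : ℤ) = (2 * q + 3) * Fintype.card A := by
    rw [hEimage, card_image_of_injective _ hEinj, card_univ, Fintype.card_prod,
      Fintype.card_congr e, Fintype.card_fin, hq]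
    push_cast
    ring
  refine ⟨f, ?_, ?_⟩
  · have hmaps : Set.MapsTo f G.edgeSet (Set.Icc 1 #G.edgeFinset) := by
      intro s hs
      obtain ⟨x, rfl⟩ := hEsurj s hs
      have h1 := hlab x.1 x.2
      rw [← hf, ← hEcard] at h1
      exact ⟨by exact_mod_cast h1.1, by exact_mod_cast h1.2⟩
    have hinj : Set.InjOn f G.edgeSet := by
      intro s hs s' hs' h
      obtain ⟨x, rfl⟩ := hEsurj s hs
      obtain ⟨x', rfl⟩ := hEsurj s' hs'
      have h1 : lab x.1 x.2 = lab x'.1 x'.2 := by rw [← hf, ← hf, h]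
      obtain ⟨h2, h3⟩ := hlabinj _ _ _ _ h1
      rw [Prod.ext h2 h3]
    refine ⟨hmaps, hinj, ?_⟩
    have h1 := surjOn_of_injOn_of_card_le (s := G.edgeFinset) (t := Finset.Icc 1 #G.edgeFinset) f
      (by simpa using hmaps) (by simpa using hinj) (by simp)
    simpa using h1
  · have hincA : ∀ a : A, (G.vertexSum f a : ℤ) = ∑ i, lab i a := by
      intro a
      have h1 : G.incidenceFinset a = univ.image fun i => E (i, a) := by
        ext s
        simp only [SimpleGraph.mem_incidenceFinset, mem_image, mem_univ, true_and,
          SimpleGraph.incidenceSet, Set.mem_ofPred_eq]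
        constructor
        · rintro ⟨hs, ha⟩
          obtain ⟨⟨i, a'⟩, rfl⟩ := hEsurj s hs
          rcases Sym2.mem_iff.1 ha with h | h
          · exact absurd h.symm (hne _ _)
          · exact ⟨i, by rw [Subtype.ext h]⟩
        · rintro ⟨i, rfl⟩
          exact ⟨hEadj _, Sym2.mem_mk_right _ _⟩
      rw [SimpleGraph.vertexSum, h1, sum_image (fun i _ j _ h => congrArg Prod.fst (hEinj h))]
      push_cast
      exact sum_congr rfl fun i _ => hf (i, a)
    have hincB : ∀ b : B, (G.vertexSum f b : ℤ) = ∑ i, lab i (m i b) := by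
      intro b
      have h1 : G.incidenceFinset b = univ.image fun i => E (i, m i b) := by
        ext s
        simp only [SimpleGraph.mem_incidenceFinset, mem_image, mem_univ, true_and,
          SimpleGraph.incidenceSet, Set.mem_ofPred_eq]
        constructor
        · rintro ⟨hs, hb⟩
          obtain ⟨⟨i, a⟩, rfl⟩ := hEsurj s hs
          rcases Sym2.mem_iff.1 hb with h | h
          · refine ⟨i, ?_⟩
            have h2 : b = (m i).symm a := Subtype.ext h
            rw [h2, Equiv.apply_symm_apply]
          · exact absurd h (hne _ _)
        · rintro ⟨i, rfl⟩
          refine ⟨hEadj _, ?_⟩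
          rw [hEm]
          exact Sym2.mem_mk_left _ _
      rw [SimpleGraph.vertexSum, h1, sum_image (fun i _ j _ h => congrArg Prod.fst (hEinj h))]
      push_cast
      exact sum_congr rfl fun i _ => hf (i, m i b)
    have hside : ∀ v : V, ∃ x : B ⊕ A, Sum.elim (fun b : B => (b : V)) (fun a : A => (a : V)) x = v
        ∧ Sum.elim (fun b => ∑ i, lab i (m i b)) (fun a => ∑ i, lab i a) x = G.vertexSum f v := by
      intro v
      rcases hcol v with hv | hv
      · exact ⟨Sum.inr ⟨v, hv⟩, rfl, (hincA ⟨v, hv⟩).symm⟩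
      · exact ⟨Sum.inl ⟨v, hv⟩, rfl, (hincB ⟨v, hv⟩).symm⟩
    intro u v huv
    obtain ⟨x, hx, hxs⟩ := hside u
    obtain ⟨y, hy, hys⟩ := hside v
    have hxy : x = y := hsum (by rw [hxs, hys, huv])
    rw [← hx, ← hy, hxy]
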